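/- For $d\ge 0$ let $E^d=\{v\in\mathbb{R}^{d+1} : \sum_k v_k=0\}$ with the inner product $(\cdot,\cdot)$ induced from $\mathbb{R}^{d+1}$, let $\alpha_i^d=\varepsilon_i-\varepsilon_{i+1}$ $(1\le i\le d)$ be the simple roots of type $A_d$, let $\varpi_1^d,\dots,\varpi_d^d\in E^d$ be the fundamental weights, defined by $(\varpi_i^d,\alpha_j^d)=\delta_{ij}$, and let $W^d\cong\mathfrak{S}_{d+1}$ be the Weyl group generated by the reflections in the hyperplanes orthogonal to the simple roots. For $\lambda\in E^d$ let $\mathsf{P}_d(\lambda)=\mathrm{Conv}(W^d\cdot\lambda)$ be the permutohedron, and let $\mathrm{Vol}_d$ be the Euclidean volume on $E^d$ (the parallelepiped spanned by an orthonormal basis has volume $1$; for $d=0$ a point has volume $1$). Work in $\mathbb{R}[x_1,x_2,\dots]$; for a polynomial $p$ and $u\ge 0$ let $p[u](x_1,x_2,\dots)=p(x_{1+u},x_{2+u},\dots)$. For $1\le i,j\le d$ put $c_{d,i,j}=\min\{i,j\}-\frac{ij}{d+1}$ (the entries of the inverse of the Cartan matrix of type $A_d$) and $$\Gamma'_{d,i}=\frac{1}{d\sqrt{c_{d,i,i}}}\binom{d+1}{i}\sum_{j=1}^d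 c_{d,i,j}\,x_j .$$ Then for every $d\ge 0$ there is a unique polynomial $\mathcal{V}_d$ in the variables $x_1,\dots,x_d$ with $$\mathcal{V}_d(x_1,\dots,x_d)=\mathrm{Vol}_d\bigl(\mathsf{P}_d(x_1\varpi_1^d+\cdots+x_d\varpi_d^d)\bigr)\qquad\text{for all } x_1,\dots,x_d\in\mathbb{R}_{\ge 0}.$$ It is homogeneous of degree $d$, $\mathcal{V}_0=1$, and for every $n\ge 1$ $$\mathcal{V}_n=\sum_{i=1}^n \Gamma'_{n,i}\,\mathcal{V}_{i-1}\,\mathcal{V}_{n-i}[i].$$ -/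

import Mathlib

open scoped InnerProductSpace

namespace Permutohedron

/-- The hyperplane `E^n` of vectors of `ℝ^{n+1}` whose coordinate sum is zero, with the inner
product induced by the standard one of `ℝ^{n+1}`. -/
def E (n : ℕ) : Submodule ℝ (EuclideanSpace ℝ (Fin (n + 1))) where
  carrier := {v | ∑ k, v k = 0}
  add_mem' {v w} hv hw := by
    simp only [Set.mem_ofPred_eq] at hv hw
    simp [Finset.sum_add_distrib, hv, hw]
  zero_mem' := by simp
  smul_mem' c v hv := by
    simp only [Set.mem_ofPred_eq] at hv
    simp [← Finset.mul_sum, hv]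

/-- The simple root `ε_i - ε_{i+1}` (the index `i : Fin n` is zero-based). -/
noncomputable def simpleRoot (n : ℕ) (i : Fin n) : E n :=
  ⟨EuclideanSpace.single i.castSucc 1 - EuclideanSpace.single i.succ 1, by
    change ∑ k, (EuclideanSpace.single i.castSucc (1 : ℝ) - EuclideanSpace.single i.succ 1
      : EuclideanSpace ℝ (Fin (n + 1))) k = 0
    simp [Finset.sum_sub_distrib]⟩

/-- The simple reflection through the hyperplane of `E^n` orthogonal to the `i`-th simple root. -/
noncomputable def simpleReflection (n : ℕ) (i : Fin n) : E n ≃ₗᵢ[ℝ] E n :=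
  (ℝ ∙ simpleRoot n i)ᗮ.reflection

/-- The Weyl group of type `A_n`: the group of orthogonal transformations of `E^n` generated by the
simple reflections. -/
noncomputable def weylGroup (n : ℕ) : Subgroup (E n ≃ₗᵢ[ℝ] E n) :=
  Subgroup.closure (Set.range (simpleReflection n))

/-- The permutohedron `P_n(v)`: the convex hull of the orbit of `v` under the Weyl group. -/
noncomputable def permutohedron (n : ℕ) (v : E n) : Set (E n) :=
  convexHull ℝ {u | ∃ w ∈ weylGroup n, w v = u}

/-- The fundamental weight with (zero-based) index `i`: its first `i + 1` coordinates are
`1 - (i + 1) / (n + 1)`, the others are `-(i + 1) / (n + 1)`. -/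
noncomputable def fundamentalWeight (n : ℕ) (i : Fin n) : E n :=
  ⟨WithLp.toLp 2 fun k => (if (k : ℕ) ≤ i then 1 else 0) - ((i : ℝ) + 1) / ((n : ℝ) + 1), by
    change ∑ k : Fin (n + 1), ((if (k : ℕ) ≤ i then (1 : ℝ) else 0)
      - ((i : ℝ) + 1) / ((n : ℝ) + 1)) = 0
    have h : (Finset.univ.filter fun k : Fin (n + 1) => (k : ℕ) ≤ i) = Finset.Iic i.castSucc := by
      ext k; simp [Fin.le_def]
    have hn : (n : ℝ) + 1 ≠ 0 := by positivity
    rw [Finset.sum_sub_distrib, Finset.sum_boole, h]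
    simp
    field_simp
    ring⟩

/-- The fundamental weights are dual to the simple roots. -/
theorem inner_fundamentalWeight_simpleRoot (n : ℕ) (i j : Fin n) :
    ⟪fundamentalWeight n i, simpleRoot n j⟫_ℝ = if i = j then 1 else 0 := by
  rw [Submodule.coe_inner]
  simp only [fundamentalWeight, simpleRoot, inner_sub_right, EuclideanSpace.inner_single_right]
  simp only [Fin.val_castSucc, Fin.val_succ, Fin.ext_iff, one_mul, conj_trivial]
  split_ifs <;> first | omega | simp

/-- A vector of `E^n` is determined by its inner products with the simple roots, so the duality
above characterizes the fundamental weights. -/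
theorem eq_of_inner_simpleRoot (n : ℕ) (v w : E n)
    (h : ∀ j, ⟪v, simpleRoot n j⟫_ℝ = ⟪w, simpleRoot n j⟫_ℝ) : v = w := by
  obtain ⟨v, hv⟩ := v
  obtain ⟨w, hw⟩ := w
  change ∑ k, v k = 0 at hv
  change ∑ k, w k = 0 at hw
  simp only [Submodule.coe_inner, simpleRoot, inner_sub_right,
    EuclideanSpace.inner_single_right, one_mul, conj_trivial] at h
  have key : ∀ k : Fin (n + 1), v k - w k = v 0 - w 0 := by
    intro k
    induction k using Fin.induction with
    | zero => rfl
    | succ k ih => have := h k; linarith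
  have hs : ∑ k, (v k - w k) = 0 := by rw [Finset.sum_sub_distrib, hv, hw, sub_zero]
  rw [Finset.sum_congr rfl fun k _ => key k] at hs
  have h0 : v 0 - w 0 = 0 := by
    have hn : (n : ℝ) + 1 ≠ 0 := by positivity
    rw [Finset.sum_const, Finset.card_univ, Fintype.card_fin, nsmul_eq_mul] at hs
    push_cast at hs
    exact (mul_eq_zero.mp hs).resolve_left hn
  apply Subtype.ext
  ext k
  have := key k
  simp only
  linarith

/-- The Euclidean volume of a finite-dimensional real inner product space: the translation invariant
measure for which the parallelepiped spanned by an orthonormal basis has volume one. It is stated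
for an abstract space `U`, because on a subspace, read as a subtype, `volume` could also mean
the restriction of the volume of the ambient space, which vanishes on a hyperplane. -/
noncomputable def euclideanVolume (U : Type*) [NormedAddCommGroup U] [InnerProductSpace ℝ U]
    [FiniteDimensional ℝ U] [MeasurableSpace U] [BorelSpace U] : MeasureTheory.Measure U :=
  MeasureTheory.volume

/-- `p` is the volume polynomial of the `n`-th permutohedron: a polynomial in the variables
`x_1, …, x_n` (the variable `x_j` is `X j`) whose value at `x_1, …, x_n ≥ 0` is the `n`-dimensional
Euclidean volume of `P_n(x_1 ϖ_1 + ⋯ + x_n ϖ_n)`. -/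
def IsVolumePolynomial (n : ℕ) (p : MvPolynomial ℕ ℝ) : Prop :=
  p.vars ⊆ Finset.Icc 1 n ∧
    ∀ x : ℕ → ℝ, (∀ j ∈ Finset.Icc 1 n, 0 ≤ x j) →
      MvPolynomial.eval x p = (euclideanVolume (E n)).real
        (permutohedron n (∑ i : Fin n, x (i + 1) • fundamentalWeight n i))

/-- The shift `p[u](x_1, x_2, …) = p(x_{1+u}, x_{2+u}, …)`. -/
noncomputable def shift (u : ℕ) (p : MvPolynomial ℕ ℝ) : MvPolynomial ℕ ℝ :=
  MvPolynomial.rename (fun j => j + u) p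

/-- The entries `c_{d,i,j} = min(i, j) - ij/(d+1)`, for `1 ≤ i, j ≤ d`, of the inverse of the Cartan
matrix of type `A_d`. -/
noncomputable def c (d i j : ℕ) : ℝ :=
  (min i j : ℕ) - (i : ℝ) * j / ((d : ℝ) + 1)

/-- The numbers `c_{d,i,j}` are the coordinates of the fundamental weights in the basis of simple
roots. -/
theorem sum_c_smul_simpleRoot (d : ℕ) (i : Fin d) :
    ∑ j : Fin d, c d (i + 1) (j + 1) • simpleRoot d j = fundamentalWeight d i := by
  have hd : (d : ℝ) + 1 ≠ 0 := by positivity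
  have hi : (i : ℕ) + 1 ≤ d + 1 := by omega
  apply Subtype.ext
  ext m
  have e1 : ((∑ j : Fin d, c d (i + 1) (j + 1) • simpleRoot d j : E d) :
      EuclideanSpace ℝ (Fin (d + 1))) m =
      ∑ j : Fin d, c d (i + 1) (j + 1) * (if m = j.castSucc then 1 else 0) -
        ∑ j : Fin d, c d (i + 1) (j + 1) * (if m = j.succ then 1 else 0) := by
    rw [Submodule.coe_sum, WithLp.ofLp_sum, Finset.sum_apply, ← Finset.sum_sub_distrib]
    refine Finset.sum_congr rfl fun j _ => ?_
    simp [simpleRoot, mul_sub]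
  have e2 : ∑ j : Fin d, c d (i + 1) (j + 1) * (if m = j.castSucc then 1 else 0) =
      c d (i + 1) (m + 1) := by
    have h := Fin.sum_univ_castSucc
      fun k : Fin (d + 1) => c d (i + 1) (k + 1) * (if m = k then 1 else 0)
    have h0 : c d (i + 1) (d + 1) = 0 := by
      simp only [c, min_eq_left hi]
      push_cast
      field_simp
      ring
    simp only [Fin.val_castSucc, Fin.val_last, h0, zero_mul, add_zero] at h
    rw [← h]
    simp
  have e3 : ∑ j : Fin d, c d (i + 1) (j + 1) * (if m = j.succ then 1 else 0) =
      c d (i + 1) m := by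
    have h := Fin.sum_univ_succ
      fun k : Fin (d + 1) => c d (i + 1) k * (if m = k then 1 else 0)
    have h0 : c d (i + 1) 0 = 0 := by simp [c]
    simp only [Fin.val_succ, Fin.val_zero, h0, zero_mul, zero_add] at h
    rw [← h]
    simp
  rw [e1, e2, e3]
  simp only [fundamentalWeight, c]
  split_ifs with hm
  · rw [min_eq_right (by omega), min_eq_right (by omega)]
    push_cast
    field_simp
    ring
  · rw [min_eq_left (by omega), min_eq_left (by omega)]
    push_cast
    field_simp
    ring

/-- The numbers `c_{d,i,j}` are the entries of the inverse of the Cartan matrix. -/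
theorem inv_cartanMatrix (d : ℕ) :
    (Matrix.of fun i j : Fin d => ⟪simpleRoot d i, simpleRoot d j⟫_ℝ)⁻¹ =
      Matrix.of fun i j : Fin d => c d (i + 1) (j + 1) := by
  apply Matrix.inv_eq_left_inv
  ext i l
  rw [Matrix.mul_apply, Matrix.one_apply, ← inner_fundamentalWeight_simpleRoot,
    ← sum_c_smul_simpleRoot, sum_inner]
  simp [real_inner_smul_left]

/-- The linear polynomial `Γ'_{d,i}`, for `1 ≤ i ≤ d`. -/
noncomputable def Gamma' (d i : ℕ) : MvPolynomial ℕ ℝ :=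
  MvPolynomial.C (1 / (d * √(c d i i)) * ((d + 1).choose i : ℝ)) *
    ∑ j ∈ Finset.Icc 1 d, MvPolynomial.C (c d i j) * MvPolynomial.X j

end Permutohedron

/-! For a dominant weight the permutohedron is the polytope of all y with coordinate sum 0 such
that, for every index set T, the sum y(T) is at most g(|T|), where g(k) = ∑_j c_{n,k,j} x_j (Rado,
`mem_permutohedron_iff`). The sequence g vanishes at 0 and n+1, and its negated second differences
are the x_j, so it is concave for x ≥ 0. Dropping one coordinate turns Euclidean volume into √(n+1)
times Lebesgue measure of `majorized (Fin n) g`.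

If some x_j is positive, then g > 0 on 1, …, n, and the polytope is the union of the cones with apex
0 over its facets, which overlap in null sets (`volume_majorized_eq_sum_facetCone`). The facets
belong to the proper nonempty sets S, and by symmetry only i = |S| matters, whence the binomial
coefficient. The facet of S is a product of two polytopes of the same kind, for g on 0, …, i and for
k ↦ g(i+k) - g(i); their parameters are x_1, …, x_{i-1} and x_{i+1}, …, x_n. Slicing the cone by the
value of y(S) gives the factor g(i)/n (`volume_facetCone_leftIndices`). The square roots from the
dropped coordinates combine to 1/√c_{n,i,i}, and the recursion follows by induction
(`volume_majorized_eq_eval`). Uniqueness holds because a polynomial is determined by its values on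
the nonnegative orthant. -/

namespace Permutohedron

/-! ### The polynomials defined by the recursion: degree, variables, uniqueness -/

section VolumePolynomials

/-- The volume polynomials, defined by the recursion over the facets of the permutohedron. -/
noncomputable def volumePolynomial : ℕ → MvPolynomial ℕ ℝ
  | 0 => 1
  | n + 1 => ∑ i : Fin (n + 1),
      Gamma' (n + 1) (i + 1) * volumePolynomial i * shift (i + 1) (volumePolynomial (n - i))
  decreasing_by all_goals omega

theorem volumePolynomial_zero : volumePolynomial 0 = 1 := by
  rw [volumePolynomial]

theorem volumePolynomial_succ (n : ℕ) : volumePolynomial (n + 1) =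
    ∑ i : Fin (n + 1), Gamma' (n + 1) (i + 1) * volumePolynomial i *
      shift (i + 1) (volumePolynomial (n - i)) := by
  rw [volumePolynomial]

theorem volumePolynomial_eq_sum_Icc (n : ℕ) (hn : 1 ≤ n) : volumePolynomial n =
    ∑ i ∈ Finset.Icc 1 n,
      Gamma' n i * volumePolynomial (i - 1) * shift i (volumePolynomial (n - i)) := by
  obtain ⟨n, rfl⟩ : ∃ m, n = m + 1 := ⟨n - 1, by omega⟩
  rw [volumePolynomial_succ, Fin.sum_univ_eq_sum_range (fun i => Gamma' (n + 1) (i + 1) *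
    volumePolynomial i * shift (i + 1) (volumePolynomial (n - i))), Finset.range_eq_Ico,
    Finset.sum_Ico_eq_sum_range, ← Finset.Ico_add_one_right_eq_Icc, Finset.sum_Ico_eq_sum_range]
  refine Finset.sum_congr (by simp) fun i _ => ?_
  rw [zero_add, show n + 1 - (1 + i) = n - i by omega, show 1 + i - 1 = i by omega, add_comm 1 i]

theorem isHomogeneous_Gamma' (d i : ℕ) : (Gamma' d i).IsHomogeneous 1 := by
  have hsum : (∑ j ∈ Finset.Icc 1 d,
      MvPolynomial.C (c d i j) * MvPolynomial.X j : MvPolynomial ℕ ℝ).IsHomogeneous 1 :=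
    MvPolynomial.IsHomogeneous.sum _ _ _ fun j _ => (MvPolynomial.isHomogeneous_X ℝ j).C_mul _
  exact hsum.C_mul _

theorem isHomogeneous_volumePolynomial (n : ℕ) : (volumePolynomial n).IsHomogeneous n := by
  induction n using Nat.strong_induction_on with
  | _ n ih =>
    obtain _ | n := n
    · rw [volumePolynomial_zero]
      exact MvPolynomial.isHomogeneous_one _ _
    · rw [volumePolynomial_succ]
      refine MvPolynomial.IsHomogeneous.sum _ _ _ fun i _ => ?_
      have hi := i.2
      have hs : (shift (i + 1) (volumePolynomial (n - i))).IsHomogeneous (n - i) :=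
        (ih (n - i) (by omega)).rename_isHomogeneous
      have h := ((isHomogeneous_Gamma' (n + 1) (i + 1)).mul (ih i (by omega))).mul hs
      rwa [show 1 + (i : ℕ) + (n - i) = n + 1 by omega] at h

theorem vars_shift_subset (u : ℕ) (p : MvPolynomial ℕ ℝ) :
    (shift u p).vars ⊆ p.vars.image fun j => j + u :=
  MvPolynomial.vars_rename _ _

theorem vars_Gamma'_subset (d i : ℕ) : (Gamma' d i).vars ⊆ Finset.Icc 1 d := by
  classical
  refine (MvPolynomial.vars_mul _ _).trans (Finset.union_subset
    (by rw [MvPolynomial.vars_C]; exact Finset.empty_subset _) ?_)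
  refine (MvPolynomial.vars_sum_subset _ _).trans (Finset.biUnion_subset.2 fun j hj => ?_)
  refine (MvPolynomial.vars_mul _ _).trans (Finset.union_subset (by simp) ?_)
  simpa using hj

theorem vars_volumePolynomial_subset (n : ℕ) : (volumePolynomial n).vars ⊆ Finset.Icc 1 n := by
  classical
  induction n using Nat.strong_induction_on with
  | _ n ih =>
    obtain _ | n := n
    · simp [volumePolynomial_zero]
    · rw [volumePolynomial_succ]
      refine (MvPolynomial.vars_sum_subset _ _).trans (Finset.biUnion_subset.2 fun i _ => ?_)
      have hi := i.2
      refine (MvPolynomial.vars_mul _ _).trans (Finset.union_subset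
        ((MvPolynomial.vars_mul _ _).trans (Finset.union_subset (vars_Gamma'_subset _ _) ?_)) ?_)
      · exact (ih i (by omega)).trans (Finset.Icc_subset_Icc_right (by omega))
      · refine (vars_shift_subset _ _).trans fun j hj => ?_
        obtain ⟨k, hk, rfl⟩ := Finset.mem_image.1 hj
        have := Finset.mem_Icc.1 (ih (n - i) (by omega) hk)
        rw [Finset.mem_Icc]
        omega

/-- The orthant is a product of infinite sets, hence Zariski dense. This gives uniqueness of the
volume polynomial. -/
theorem eq_of_eval_nonneg_eq (p q : MvPolynomial ℕ ℝ)
    (h : ∀ x : ℕ → ℝ, (∀ j, 0 ≤ x j) → MvPolynomial.eval x p = MvPolynomial.eval x q) : p = q :=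
  MvPolynomial.funext_set (fun _ => Set.Ici 0) (fun _ => Set.Ici_infinite 0)
    fun x hx => h x fun j => hx j (Set.mem_univ j)

theorem eval_shift (x : ℕ → ℝ) (u : ℕ) (p : MvPolynomial ℕ ℝ) :
    MvPolynomial.eval x (shift u p) = MvPolynomial.eval (fun j => x (j + u)) p := by
  rw [shift, MvPolynomial.eval_rename]
  rfl

theorem eval_Gamma' (x : ℕ → ℝ) (d i : ℕ) : MvPolynomial.eval x (Gamma' d i) =
    1 / (d * √(c d i i)) * ((d + 1).choose i : ℝ) * ∑ j ∈ Finset.Icc 1 d, c d i j * x j := by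
  simp [Gamma']

end VolumePolynomials

/-! ### The inverse Cartan matrix and concave sequences -/

section ConcaveSequences

theorem c_zero_left (d j : ℕ) : c d 0 j = 0 := by simp [c]

theorem c_comm (d i j : ℕ) : c d i j = c d j i := by
  simp only [c, min_comm i j]
  ring

theorem c_last_left (d j : ℕ) (hj : j ≤ d + 1) : c d (d + 1) j = 0 := by
  have : (d : ℝ) + 1 ≠ 0 := by positivity
  rw [c, min_eq_right hj]
  push_cast
  field_simp
  ring

theorem c_pos (d i j : ℕ) (hi : i ∈ Finset.Icc 1 d) (hj : j ∈ Finset.Icc 1 d) : 0 < c d i j := by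
  wlog h : i ≤ j generalizing i j
  · rw [c_comm]
    exact this j i hj hi (le_of_not_ge h)
  have hd : (0 : ℝ) < (d : ℝ) + 1 := by positivity
  rw [Finset.mem_Icc] at hi hj
  have hj' : (j : ℝ) < d + 1 := by exact_mod_cast Nat.lt_succ_of_le hj.2
  have hi' : (0 : ℝ) < i := by exact_mod_cast hi.1
  rw [c, min_eq_left h, sub_pos, div_lt_iff₀ hd]
  exact mul_lt_mul_of_pos_left hj' hi'

theorem c_self (d i : ℕ) : c d i i = i * (d + 1 - i) / (d + 1) := by
  have : (d : ℝ) + 1 ≠ 0 := by positivity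
  rw [c, min_self]
  field_simp

/-- As a function of its first index, `c d · j` is piecewise linear with a single kink, at j, where
the slope drops by 1. -/
theorem two_mul_c_sub_sub (d j k : ℕ) :
    2 * c d (k + 1) j - c d k j - c d (k + 2) j = if k + 1 = j then 1 else 0 := by
  have hd : (d : ℝ) + 1 ≠ 0 := by positivity
  simp only [c]
  split_ifs with h
  · subst h
    rw [min_self, min_eq_left (by omega), min_eq_right (by omega)]
    push_cast
    field_simp
    ring
  · rcases lt_or_gt_of_ne h with h | h
    · rw [min_eq_left (by omega), min_eq_left (by omega), min_eq_left (by omega)]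
      push_cast
      field_simp
      ring
    · rw [min_eq_right (by omega), min_eq_right (by omega), min_eq_right (by omega)]
      push_cast
      field_simp
      ring

/-- A sequence vanishing at both ends is determined by its second differences. -/
theorem eq_sum_c_mul (n : ℕ) (g x : ℕ → ℝ) (h0 : g 0 = 0) (hn : g (n + 1) = 0)
    (hx : ∀ k < n, x (k + 1) = 2 * g (k + 1) - g k - g (k + 2)) (i : ℕ) (hi : i ≤ n + 1) :
    g i = ∑ j ∈ Finset.Icc 1 n, c n i j * x j := by
  -- The difference has vanishing second differences, so it is linear; being zero at both ends, it
  -- is zero.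
  set f : ℕ → ℝ := fun i => g i - ∑ j ∈ Finset.Icc 1 n, c n i j * x j with hf
  have f0 : f 0 = 0 := by simp [hf, h0, c_zero_left]
  have fn : f (n + 1) = 0 := by
    simp only [hf, hn, zero_sub, neg_eq_zero]
    refine Finset.sum_eq_zero fun j hj => ?_
    rw [Finset.mem_Icc] at hj
    rw [c_last_left _ _ (by omega), zero_mul]
  have hrec : ∀ k < n, f (k + 2) - f (k + 1) = f (k + 1) - f k := by
    intro k hk
    have e : 2 * ∑ j ∈ Finset.Icc 1 n, c n (k + 1) j * x j - ∑ j ∈ Finset.Icc 1 n, c n k j * x j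
        - ∑ j ∈ Finset.Icc 1 n, c n (k + 2) j * x j = x (k + 1) := by
      rw [Finset.mul_sum, ← Finset.sum_sub_distrib, ← Finset.sum_sub_distrib]
      have : ∀ j ∈ Finset.Icc 1 n, 2 * (c n (k + 1) j * x j) - c n k j * x j - c n (k + 2) j * x j
          = if k + 1 = j then x j else 0 := by
        intro j _
        rw [show 2 * (c n (k + 1) j * x j) - c n k j * x j - c n (k + 2) j * x j
          = (2 * c n (k + 1) j - c n k j - c n (k + 2) j) * x j by ring, two_mul_c_sub_sub]
        simp
      rw [Finset.sum_congr rfl this, Finset.sum_ite_eq, if_pos]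
      rw [Finset.mem_Icc]
      omega
    have := hx k hk
    simp only [hf]
    linarith
  have hlin : ∀ k ≤ n, f (k + 1) - f k = f 1 ∧ f (k + 1) = (k + 1) * f 1 := by
    intro k
    induction k with
    | zero => simp [f0]
    | succ k ih =>
      intro hk
      have h1 := ih (by omega)
      have h2 := hrec k (by omega)
      refine ⟨by linarith [h1.1], ?_⟩
      push_cast
      linarith [h1.1, h1.2]
  have f1 : f 1 = 0 := by
    have := (hlin n le_rfl).2
    rw [fn, eq_comm, mul_eq_zero] at this
    exact this.resolve_left (by positivity)
  have hfi : f i = 0 := by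
    obtain _ | i := i
    · exact f0
    · rw [(hlin i (by omega)).2, f1, mul_zero]
  simpa [hf, sub_eq_zero] using hfi

/-- Concavity on `{0, …, n + 1}` in the form of an exchange inequality. -/
theorem add_le_add_of_concave (n : ℕ) (g : ℕ → ℝ)
    (hg : ∀ k < n, g k + g (k + 2) ≤ 2 * g (k + 1)) (p i q : ℕ) (hp : p ≤ i)
    (hq : i + q ≤ n + 1) : g p + g (i + q) ≤ g i + g (p + q) := by
  -- The increments of a concave sequence decrease.
  have hδ : ∀ k p, p + k ≤ n → g (p + k + 1) - g (p + k) ≤ g (p + 1) - g p := by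
    intro k
    induction k with
    | zero => simp
    | succ k ih =>
      intro p hpk
      have h1 := ih p (by omega)
      have h2 := hg (p + k) (by omega)
      rw [show p + (k + 1) = p + k + 1 by ring]
      linarith
  induction q with
  | zero => simp [add_comm]
  | succ q ih =>
    have h1 := ih (by omega)
    have h2 := hδ (i - p) (p + q) (by omega)
    rw [show p + q + (i - p) = i + q by omega] at h2
    rw [← add_assoc, ← add_assoc]
    linarith

end ConcaveSequences

/-! ### Majorization polytopes in coordinates and their symmetries -/

section Majorization

open MeasureTheory
open scoped Pointwise

variable {ι κ : Type*} [Fintype ι] [Fintype κ]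

/-- The vector with coordinates `z` and one further coordinate, chosen such that the sum of all
coordinates is `s`. -/
def extend (s : ℝ) (z : ι → ℝ) : Option ι → ℝ := fun o => o.elim (s - ∑ i, z i) z

@[simp]
theorem extend_none (s : ℝ) (z : ι → ℝ) : extend s z none = s - ∑ i, z i := rfl

@[simp]
theorem extend_some (s : ℝ) (z : ι → ℝ) (i : ι) : extend s z (some i) = z i := rfl

@[simp]
theorem sum_extend (s : ℝ) (z : ι → ℝ) : ∑ o, extend s z o = s := by
  simp [Fintype.sum_option]

theorem extend_sum_some (y : Option ι → ℝ) : extend (∑ o, y o) (fun i => y (some i)) = y := by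
  funext o
  cases o <;> simp [Fintype.sum_option]

theorem extend_smul (t s : ℝ) (z : ι → ℝ) : extend (t * s) (t • z) = t • extend s z := by
  funext o
  cases o <;> simp [mul_sub, Finset.mul_sum]

theorem extend_add (s t : ℝ) (z w : ι → ℝ) : extend (s + t) (z + w) = extend s z + extend t w := by
  funext o
  cases o
  · simp [Finset.sum_add_distrib]
    ring
  · simp

theorem extend_const (r : ℝ) :
    extend ((Fintype.card ι + 1 : ℕ) * r) (fun _ : ι => r) = fun _ => r := by
  funext o
  cases o
  · simp
    ring
  · simp

theorem continuous_extend {X : Type*} [TopologicalSpace X] {s : X → ℝ} {z : X → ι → ℝ}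
    (hs : Continuous s) (hz : Continuous z) (o : Option ι) :
    Continuous fun p => extend (s p) (z p) o := by
  cases o
  · simp only [extend_none]
    fun_prop
  · simp only [extend_some]
    fun_prop

variable (ι) in
/-- The vectors with coordinate sum `g (card ι + 1)`, the sum of whose coordinates over any set `T`
of indices is at most `g (card T)`. The indices are those of `Option ι`, and the coordinate `none`,
being determined by the others, is omitted. -/
def majorized (g : ℕ → ℝ) : Set (ι → ℝ) :=
  {z | ∀ T : Finset (Option ι), ∑ o ∈ T, extend (g (Fintype.card ι + 1)) z o ≤ g T.card}

theorem isClosed_setOf_mem_majorized {X : Type*} [TopologicalSpace X] {z : X → ι → ℝ}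
    {g : X → ℕ → ℝ} (hz : Continuous z) (hg : ∀ k, Continuous fun p => g p k) :
    IsClosed {p | z p ∈ majorized ι (g p)} := by
  have : {p | z p ∈ majorized ι (g p)} = ⋂ T : Finset (Option ι),
      {p | ∑ o ∈ T, extend (g p (Fintype.card ι + 1)) (z p) o ≤ g p T.card} := by
    ext p
    simp [majorized]
  rw [this]
  exact isClosed_iInter fun T => isClosed_le
    (continuous_finsetSum _ fun o _ => continuous_extend (hg _) hz o) (hg _)

theorem majorized_smul {t : ℝ} (ht : 0 < t) (g : ℕ → ℝ) :
    majorized ι (fun k => t * g k) = t • majorized ι g := by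
  ext z
  rw [Set.mem_smul_set_iff_inv_smul_mem₀ ht.ne']
  refine forall_congr' fun T => ?_
  have : extend (t * g (Fintype.card ι + 1)) z =
      t • extend (g (Fintype.card ι + 1)) (t⁻¹ • z) := by
    rw [← extend_smul, smul_inv_smul₀ ht.ne']
  rw [this]
  simp only [Pi.smul_apply, smul_eq_mul, ← Finset.mul_sum]
  exact mul_le_mul_iff_right₀ ht

theorem volume_majorized_smul {t : ℝ} (ht : 0 < t) (g : ℕ → ℝ) :
    volume (majorized ι fun k => t * g k) =
      ENNReal.ofReal (t ^ Fintype.card ι) * volume (majorized ι g) := by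
  rw [majorized_smul ht, Measure.addHaar_smul_of_nonneg _ ht.le, Module.finrank_fintype_fun_eq_card]

/-- A linear term in g translates the polytope by the constant vector r. This permits the
normalization g(n+1) = 0. -/
theorem volume_majorized_add_linear (g : ℕ → ℝ) (r : ℝ) :
    volume (majorized ι fun k => g k + k * r) = volume (majorized ι g) := by
  rw [← measure_preimage_add volume (fun _ : ι => r) (majorized ι fun k => g k + k * r)]
  congr 1
  ext z
  refine forall_congr' fun T => ?_
  beta_reduce
  rw [add_comm (g (Fintype.card ι + 1)), extend_add, extend_const]
  simp [Finset.sum_add_distrib, add_comm (g T.card)]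

/-- Singletons bound the coordinates from above, complements of singletons from below. The box shows
that the volume is finite, and that it vanishes in the degenerate case g = 0 in positive dimension.
-/
theorem majorized_subset_Icc (g : ℕ → ℝ) : majorized ι g ⊆ Set.Icc
    (fun _ => g (Fintype.card ι + 1) - g (Fintype.card ι)) (fun _ => g 1) := by
  classical
  refine fun z hz => ⟨fun i => ?_, fun i => ?_⟩
  · have h := hz {some i}ᶜ
    have h' := Finset.sum_compl_add_sum {some i} (extend (g (Fintype.card ι + 1)) z)
    rw [Finset.card_compl, Finset.card_singleton, Fintype.card_option, Nat.add_sub_cancel] at h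
    rw [sum_extend, Finset.sum_singleton, extend_some] at h'
    linarith
  · simpa using hz {some i}

theorem volume_majorized_lt_top (g : ℕ → ℝ) : volume (majorized ι g) < ⊤ :=
  (measure_mono (majorized_subset_Icc g)).trans_lt isCompact_Icc.measure_lt_top

/-- The change of the omitted coordinate. -/
def reindex (e : Option ι ≃ Option κ) : (ι → ℝ) →ₗ[ℝ] (κ → ℝ) where
  toFun z k := extend 0 z (e.symm (some k))
  map_add' z w := by
    funext k
    have := extend_add 0 0 z w
    rw [add_zero] at this
    simp [this]
  map_smul' t z := by
    funext k
    have := extend_smul t 0 z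
    rw [mul_zero] at this
    simp [this]

theorem extend_reindex (e : Option ι ≃ Option κ) (z : ι → ℝ) :
    extend 0 (reindex e z) = extend 0 z ∘ e.symm := by
  have h := extend_sum_some (extend 0 z ∘ e.symm)
  rwa [show ∑ o, (extend 0 z ∘ e.symm) o = 0 from
    (Equiv.sum_comp e.symm (extend 0 z)).trans (sum_extend 0 z)] at h

variable (ι) in
/-- The action of the permutations of all coordinates. -/
def reindexHom : Equiv.Perm (Option ι) →* Module.End ℝ (ι → ℝ) where
  toFun := reindex
  map_one' := rfl
  map_mul' σ τ := by
    ext1 z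
    funext i
    rw [Module.End.mul_apply]
    change extend 0 z ((σ * τ)⁻¹ (some i)) = extend 0 (reindex τ z) (σ⁻¹ (some i))
    rw [extend_reindex, mul_inv_rev]
    rfl

/-- A permutation has finite order, so the determinant is a real root of unity. -/
theorem abs_det_reindex [DecidableEq ι] (σ : Equiv.Perm (Option ι)) :
    |LinearMap.det (reindex σ : (ι → ℝ) →ₗ[ℝ] (ι → ℝ))| = 1 := by
  have h : (LinearMap.det (reindexHom ι σ)) ^ orderOf σ = 1 := by
    rw [← map_pow, ← map_pow, pow_orderOf_eq_one, map_one, map_one]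
  have h' : |LinearMap.det (reindexHom ι σ)| ^ orderOf σ = 1 := by
    rw [← abs_pow, h, abs_one]
  exact (pow_eq_one_iff_of_nonneg (abs_nonneg _) (orderOf_pos σ).ne').1 h'

theorem volume_preimage_reindex (e : Option ι ≃ Option κ) (s : Set (κ → ℝ)) :
    volume (reindex e ⁻¹' s) = volume s := by
  classical
  have hcard : Fintype.card ι = Fintype.card κ := by
    simpa using Fintype.card_congr e
  obtain ⟨f⟩ := Fintype.card_eq.1 hcard
  -- `e` factors as a permutation of `Option ι` followed by a relabelling that fixes the omitted
  -- index.
  set σ : Equiv.Perm (Option ι) := e.trans (Equiv.optionCongr f).symm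
  have hσ : reindex e = (fun z : ι → ℝ => MeasurableEquiv.piCongrLeft (fun _ : κ => ℝ) f z) ∘
      reindex σ := by
    funext z k
    obtain ⟨i, rfl⟩ := f.surjective k
    rw [Function.comp_apply, MeasurableEquiv.coe_piCongrLeft, Equiv.piCongrLeft_apply_apply]
    rfl
  rw [hσ, Set.preimage_comp]
  have hdet := abs_det_reindex σ
  have hne : LinearMap.det (reindex σ : (ι → ℝ) →ₗ[ℝ] (ι → ℝ)) ≠ 0 := by
    intro h0
    rw [h0, abs_zero] at hdet
    exact zero_ne_one hdet
  rw [Measure.addHaar_preimage_linearMap volume hne, abs_inv, hdet, inv_one, ENNReal.ofReal_one,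
    one_mul]
  exact (volume_measurePreserving_piCongrLeft (fun _ : κ => ℝ) f).measure_preimage_equiv s

end Majorization

/-! ### Cones over the facets -/

section FacetCones

open MeasureTheory

variable {ι κ : Type*} [Fintype ι] [Fintype κ]

variable (ι) in
/-- The cone with apex `0` over the facet of `majorized ι g` that belongs to the set `S` of
indices. -/
def facetCone (g : ℕ → ℝ) (S : Finset (Option ι)) : Set (ι → ℝ) :=
  {z | ∑ o ∈ S, extend 0 z o ≤ g S.card ∧ ∀ T : Finset (Option ι),
    (∑ o ∈ T, extend 0 z o) * g S.card ≤ (∑ o ∈ S, extend 0 z o) * g T.card}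

theorem isClosed_facetCone (g : ℕ → ℝ) (S : Finset (Option ι)) : IsClosed (facetCone ι g S) := by
  have h : ∀ T : Finset (Option ι), Continuous fun z : ι → ℝ => ∑ o ∈ T, extend 0 z o :=
    fun T => continuous_finsetSum _ fun o _ => continuous_extend continuous_const continuous_id o
  rw [facetCone, Set.ofPred_and, Set.ofPred_forall]
  exact (isClosed_le (h S) continuous_const).inter (isClosed_iInter fun T =>
    isClosed_le ((h T).mul continuous_const) ((h S).mul continuous_const))

/-- The bounds depend on index sets only through their cardinality, so permuting all coordinates
permutes the cones. -/
theorem preimage_reindex_facetCone (e : Option ι ≃ Option κ) (g : ℕ → ℝ) (S : Finset (Option ι)) :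
    reindex e ⁻¹' facetCone κ g (S.map e.toEmbedding) = facetCone ι g S := by
  have h : ∀ (z : ι → ℝ) (T : Finset (Option ι)),
      ∑ o ∈ T.map e.toEmbedding, extend 0 (reindex e z) o = ∑ o ∈ T, extend 0 z o := by
    intro z T
    simp [extend_reindex]
  ext z
  refine and_congr (by rw [h, Finset.card_map]) ?_
  refine ⟨fun H T => ?_, fun H T => ?_⟩
  · have := H (T.map e.toEmbedding)
    rwa [h, h, Finset.card_map, Finset.card_map] at this
  · obtain ⟨T, rfl⟩ : ∃ T' : Finset (Option ι), T = T'.map e.toEmbedding :=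
      ⟨T.map e.symm.toEmbedding, by ext; simp⟩
    rw [h, h, Finset.card_map, Finset.card_map]
    exact H T

theorem volume_facetCone_map (e : Option ι ≃ Option κ) (g : ℕ → ℝ) (S : Finset (Option ι)) :
    volume (facetCone κ g (S.map e.toEmbedding)) = volume (facetCone ι g S) := by
  rw [← preimage_reindex_facetCone e, volume_preimage_reindex]

end FacetCones

/-! ### Volume of one cone by slicing -/

section Slices

open MeasureTheory

variable (α β : Type*)

/-- The omitted coordinate is put into the second summand. -/
def optionSumEquiv : Option (Option α ⊕ β) ≃ Option α ⊕ Option β where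
  toFun o := o.elim (Sum.inr none) (Sum.map id some)
  invFun := Sum.elim (fun o => some (Sum.inl o)) (Option.map Sum.inr)
  left_inv o := by
    rcases o with _ | (_ | _) <;> rfl
  right_inv o := by
    rcases o with _ | (_ | _) <;> rfl

variable {α β} [Fintype α]

/-- The indices of the first summand. -/
def leftIndices (α β : Type*) [Fintype α] : Finset (Option (Option α ⊕ β)) :=
  (Finset.univ.disjSum ∅ : Finset (Option α ⊕ Option β)).map (optionSumEquiv α β).symm.toEmbedding

theorem card_leftIndices : (leftIndices α β).card = Fintype.card α + 1 := by
  simp [leftIndices]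

variable [Fintype β]

theorem extend_comp_optionSumEquiv_symm (w : Option α ⊕ β → ℝ) :
    extend 0 w ∘ (optionSumEquiv α β).symm =
      Sum.elim (fun o => w (Sum.inl o))
        (extend (-∑ o, w (Sum.inl o)) fun j => w (Sum.inr j)) := by
  funext o
  rcases o with o | _ | o
  · rfl
  · simp only [Function.comp_apply, optionSumEquiv, Equiv.coe_fn_symm_mk, Sum.elim_inr,
      Option.map_none, extend_none, Fintype.sum_sum_type]
    ring
  · rfl

/-- The coordinates in which the slices of the cone over a facet are products. -/
def sliceMap (w : Option α ⊕ β → ℝ) : ℝ × ((α → ℝ) × (β → ℝ)) :=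
  (∑ o, w (Sum.inl o), (fun i => w (Sum.inl (some i)), fun j => w (Sum.inr j)))

/-- Replacing the coordinate `none` by the total sum is a shear. -/
theorem measurePreserving_sum_option :
    MeasurePreserving (fun u : Option α → ℝ => ((∑ o, u o, fun i => u (some i)) : ℝ × (α → ℝ)))
      volume volume := by
  have h1 : MeasurePreserving (MeasurableEquiv.piOptionEquivProd fun _ : Option α => ℝ)
      volume volume :=
    MeasurePreserving.symm (MeasurableEquiv.piOptionEquivProd fun _ : Option α => ℝ).symm
      ⟨MeasurableEquiv.measurable _, Measure.pi_map_piOptionEquivProd fun _ : Option α => volume⟩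
  have h2 : MeasurePreserving (fun p : (α → ℝ) × ℝ => (p.1, (∑ i, p.1 i) + p.2))
      volume volume :=
    (MeasurePreserving.id volume).skew_product
      (g := fun (z : α → ℝ) (r : ℝ) => (∑ i, z i) + r)
      (by unfold Function.uncurry; fun_prop)
      (Filter.Eventually.of_forall fun z => map_add_left_eq_self volume _)
  have h := (Measure.measurePreserving_swap (μ := (volume : Measure (α → ℝ)))
    (ν := (volume : Measure ℝ))).comp (h2.comp h1)
  have hfun : (fun u : Option α → ℝ => ((∑ o, u o, fun i => u (some i)) : ℝ × (α → ℝ))) =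
      Prod.swap ∘ (fun p : (α → ℝ) × ℝ => (p.1, (∑ i, p.1 i) + p.2)) ∘
        MeasurableEquiv.piOptionEquivProd fun _ : Option α => ℝ := by
    funext u
    refine Prod.ext ?_ rfl
    rw [Fintype.sum_option, add_comm]
    rfl
  rw [hfun]
  exact h

theorem measurePreserving_sliceMap :
    MeasurePreserving (sliceMap : (Option α ⊕ β → ℝ) → _) volume volume := by
  have h1 := volume_measurePreserving_sumPiEquivProdPi fun _ : Option α ⊕ β => ℝ
  have h2 := (measurePreserving_sum_option (α := α)).prod
    (MeasurePreserving.id (volume : Measure (β → ℝ)))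
  have h3 := measurePreserving_prodAssoc (volume : Measure ℝ) (volume : Measure (α → ℝ))
    (volume : Measure (β → ℝ))
  exact h3.comp (h2.comp h1)

/-- Split T into its parts T₁ and T₂ in the two summands. The inequalities with T₂ empty describe
the first factor of the slice, those with T₁ full the second. The mixed inequalities follow from
these two kinds by the exchange inequality `hconc`. -/
theorem facetCone_leftIndices (g : ℕ → ℝ) (i : ℕ) (hi : i = Fintype.card α + 1)
    (hlast : g (i + (Fintype.card β + 1)) = 0) (hpos : 0 < g i)
    (hnonneg : 0 ≤ g (Fintype.card β + 1))
    (hconc : ∀ p ≤ i, ∀ q ≤ Fintype.card β + 1, g p + g (i + q) ≤ g i + g (p + q)) :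
    facetCone (Option α ⊕ β) g (leftIndices α β) = sliceMap ⁻¹' {p | p.1 ∈ Set.Icc 0 (g i) ∧
      p.2.1 ∈ majorized α (fun k => p.1 / g i * g k) ∧
      p.2.2 ∈ majorized β (fun k => p.1 / g i * (g (i + k) - g i))} := by
  ext w
  set u : Option α → ℝ := fun o => w (Sum.inl o) with hu
  set v : β → ℝ := fun j => w (Sum.inr j) with hv
  set s : ℝ := ∑ o, u o with hs
  have hsum : ∀ (T₁ : Finset (Option α)) (T₂ : Finset (Option β)),
      ∑ o ∈ (T₁.disjSum T₂).map (optionSumEquiv α β).symm.toEmbedding, extend 0 w o =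
        ∑ o ∈ T₁, u o + ∑ o ∈ T₂, extend (-s) v o := by
    intro T₁ T₂
    have h := Finset.sum_disjSum T₁ T₂ (Sum.elim u (extend (-s) v))
    rw [← extend_comp_optionSumEquiv_symm w] at h
    rw [Finset.sum_map]
    refine h.trans ?_
    rw [extend_comp_optionSumEquiv_symm w]
    rfl
  have hL : ∑ o ∈ leftIndices α β, extend 0 w o = s := by
    rw [leftIndices, hsum, Finset.sum_empty, add_zero]
  have hu' : extend s (fun i => u (some i)) = u := extend_sum_some u
  have hcone : w ∈ facetCone (Option α ⊕ β) g (leftIndices α β) ↔ s ≤ g i ∧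
      ∀ (T₁ : Finset (Option α)) (T₂ : Finset (Option β)),
        (∑ o ∈ T₁, u o + ∑ o ∈ T₂, extend (-s) v o) * g i ≤ s * g (T₁.card + T₂.card) := by
    rw [facetCone, Set.mem_ofPred_eq, hL, card_leftIndices, ← hi]
    refine and_congr_right fun _ => ⟨fun H T₁ T₂ => ?_, fun H T => ?_⟩
    · have := H ((T₁.disjSum T₂).map (optionSumEquiv α β).symm.toEmbedding)
      rwa [hsum, Finset.card_map, Finset.card_disjSum] at this
    · obtain ⟨T₁, T₂, rfl⟩ : ∃ T₁ T₂, T =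
          (Finset.disjSum T₁ T₂).map (optionSumEquiv α β).symm.toEmbedding := by
        refine ⟨(T.map (optionSumEquiv α β).toEmbedding).toLeft,
          (T.map (optionSumEquiv α β).toEmbedding).toRight, ?_⟩
        rw [Finset.toLeft_disjSum_toRight, Finset.map_map]
        ext
        simp
      rw [hsum, Finset.card_map, Finset.card_disjSum]
      exact H T₁ T₂
  have hcardα : Fintype.card α + 1 = i := hi.symm
  have e1 : s / g i * g i = s := div_mul_cancel₀ _ hpos.ne'
  have e2 : s / g i * (g (i + (Fintype.card β + 1)) - g i) = -s := by
    rw [hlast, zero_sub, mul_neg, e1]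
  have hslice : w ∈ sliceMap ⁻¹' {p : ℝ × ((α → ℝ) × (β → ℝ)) | p.1 ∈ Set.Icc 0 (g i) ∧
      p.2.1 ∈ majorized α (fun k => p.1 / g i * g k) ∧
      p.2.2 ∈ majorized β (fun k => p.1 / g i * (g (i + k) - g i))} ↔
      (0 ≤ s ∧ s ≤ g i) ∧ (∀ T₁ : Finset (Option α), ∑ o ∈ T₁, u o ≤ s / g i * g T₁.card) ∧
      ∀ T₂ : Finset (Option β),
        ∑ o ∈ T₂, extend (-s) v o ≤ s / g i * (g (i + T₂.card) - g i) := by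
    change (s ∈ Set.Icc 0 (g i) ∧ (fun i => u (some i)) ∈ majorized α (fun k => s / g i * g k) ∧
      v ∈ majorized β (fun k => s / g i * (g (i + k) - g i))) ↔ _
    simp only [majorized, Set.mem_ofPred_eq, hcardα, e1, e2, hu', Set.mem_Icc]
  rw [hcone, hslice]
  constructor
  · rintro ⟨hsi, H⟩
    refine ⟨⟨?_, hsi⟩, fun T₁ => ?_, fun T₂ => ?_⟩
    -- The complement of S yields -s * g i ≤ s * g (card β + 1), which excludes s < 0.
    · have := H ∅ Finset.univ
      rw [Finset.sum_empty, sum_extend, zero_add, Finset.card_empty, zero_add, Finset.card_univ,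
        Fintype.card_option] at this
      by_contra hneg
      push Not at hneg
      nlinarith
    · have := H T₁ ∅
      rw [Finset.sum_empty, add_zero, Finset.card_empty, add_zero] at this
      rw [div_mul_eq_mul_div, le_div_iff₀ hpos]
      exact this
    · have := H Finset.univ T₂
      rw [Finset.card_univ, Fintype.card_option, hcardα, ← hs] at this
      rw [div_mul_eq_mul_div, le_div_iff₀ hpos]
      linarith
  · rintro ⟨⟨hs0, hsi⟩, H₁, H₂⟩
    refine ⟨hsi, fun T₁ T₂ => ?_⟩
    have hT₁ : T₁.card ≤ i := by
      have := T₁.card_le_univ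
      rwa [Fintype.card_option, hcardα] at this
    have hT₂ : T₂.card ≤ Fintype.card β + 1 := by
      simpa using T₂.card_le_univ
    have ht : 0 ≤ s / g i := div_nonneg hs0 hpos.le
    have h := mul_le_mul_of_nonneg_left (hconc _ hT₁ _ hT₂) ht
    rw [← le_div_iff₀ hpos, mul_div_right_comm]
    linarith [H₁ T₁, H₂ T₂]

theorem lintegral_Ioc_div_pow {r : ℝ} (hr : 0 < r) (m : ℕ) :
    ∫⁻ s in Set.Ioc 0 r, ENNReal.ofReal ((s / r) ^ m) = ENNReal.ofReal (r / (m + 1)) := by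
  rw [← ofReal_integral_eq_lintegral_ofReal]
  · congr 1
    rw [← intervalIntegral.integral_of_le hr.le]
    simp only [div_pow, intervalIntegral.integral_div, integral_pow]
    have := hr.ne'
    field_simp
    ring
  · exact (Continuous.integrableOn_Icc (by fun_prop)).mono_set Set.Ioc_subset_Icc_self
  · filter_upwards [self_mem_ae_restrict measurableSet_Ioc] with s hs
    have := hs.1
    positivity

/-- By Fubini: the slice at height s is the facet scaled by s / g i, of dimension card α + card β,
and the power of s / g i integrates to g i divided by the full dimension. -/
theorem volume_facetCone_leftIndices (g : ℕ → ℝ) (i : ℕ) (hi : i = Fintype.card α + 1)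
    (hlast : g (i + (Fintype.card β + 1)) = 0) (hpos : 0 < g i)
    (hnonneg : 0 ≤ g (Fintype.card β + 1))
    (hconc : ∀ p ≤ i, ∀ q ≤ Fintype.card β + 1, g p + g (i + q) ≤ g i + g (p + q)) :
    volume (facetCone (Option α ⊕ β) g (leftIndices α β)) =
      ENNReal.ofReal (g i / ((Fintype.card α + Fintype.card β : ℕ) + 1)) *
        (volume (majorized α g) * volume (majorized β fun k => g (i + k) - g i)) := by
  set A : Set (ℝ × ((α → ℝ) × (β → ℝ))) := {p | p.1 ∈ Set.Icc 0 (g i) ∧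
      p.2.1 ∈ majorized α (fun k => p.1 / g i * g k) ∧
      p.2.2 ∈ majorized β (fun k => p.1 / g i * (g (i + k) - g i))} with hA
  have hclosed : IsClosed A := by
    rw [hA, Set.ofPred_and, Set.ofPred_and]
    exact (isClosed_Icc.preimage continuous_fst).inter
      ((isClosed_setOf_mem_majorized (by fun_prop) (by fun_prop)).inter
        (isClosed_setOf_mem_majorized (by fun_prop) (by fun_prop)))
  rw [facetCone_leftIndices g i hi hlast hpos hnonneg hconc,
    measurePreserving_sliceMap.measure_preimage hclosed.measurableSet.nullMeasurableSet,
    Measure.volume_eq_prod, Measure.prod_apply hclosed.measurableSet]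
  set C := volume (majorized α g) * volume (majorized β fun k => g (i + k) - g i) with hC
  have hslice : ∀ᵐ s : ℝ, volume (Prod.mk s ⁻¹' A) =
      (Set.Ioc 0 (g i)).indicator (fun s =>
        ENNReal.ofReal ((s / g i) ^ (Fintype.card α + Fintype.card β)) * C) s := by
    -- The scaling formula for volumes is stated for positive factors only, so the apex is
    -- discarded.
    have hne : ∀ᵐ s : ℝ, s ≠ 0 := by simp [ae_iff]
    filter_upwards [hne] with s hs
    by_cases hmem : s ∈ Set.Icc 0 (g i)
    · have hs0 : 0 < s := lt_of_le_of_ne hmem.1 hs.symm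
      have hmem' : s ∈ Set.Ioc 0 (g i) := ⟨hs0, hmem.2⟩
      rw [Set.indicator_of_mem hmem']
      have : Prod.mk s ⁻¹' A = majorized α (fun k => s / g i * g k) ×ˢ
          majorized β (fun k => s / g i * (g (i + k) - g i)) := by
        ext p
        simp only [hA, Set.mem_preimage, Set.mem_ofPred_eq, Set.mem_prod, hmem, true_and]
      have ht : 0 < s / g i := div_pos hs0 hpos
      rw [this, Measure.volume_eq_prod, Measure.prod_prod, volume_majorized_smul ht,
        volume_majorized_smul ht fun k => g (i + k) - g i, pow_add,
        ENNReal.ofReal_mul (by positivity), hC]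
      ring
    · rw [Set.indicator_of_notMem fun h => hmem (Set.Ioc_subset_Icc_self h)]
      have : Prod.mk s ⁻¹' A = ∅ := by
        ext p
        simp only [hA, Set.mem_preimage, Set.mem_ofPred_eq, hmem, false_and,
          Set.mem_empty_iff_false]
      rw [this, measure_empty]
  rw [lintegral_congr_ae hslice, lintegral_indicator measurableSet_Ioc,
    lintegral_mul_const _ (by fun_prop), lintegral_Ioc_div_pow hpos]

end Slices

/-! ### Decomposition of the polytope into cones -/

section FacetDecomposition

open MeasureTheory

variable {ι κ : Type*} [Fintype ι] [Fintype κ]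

theorem exists_equiv_map_eq {A B : Type*} [Fintype A] [Fintype B] (S : Finset A) (T : Finset B)
    (hAB : Fintype.card A = Fintype.card B) (hST : S.card = T.card) :
    ∃ e : A ≃ B, S.map e.toEmbedding = T := by
  classical
  obtain ⟨f⟩ := Fintype.card_eq.1 hAB
  have hcard : Fintype.card {x // x ∈ S.map f.toEmbedding} = Fintype.card {x // x ∈ T} := by
    rw [Fintype.card_coe, Fintype.card_coe, Finset.card_map, hST]
  obtain ⟨r⟩ := Fintype.card_eq.1 hcard
  refine ⟨f.trans r.extendSubtype, Finset.eq_of_subset_of_card_le (fun y hy => ?_) (by simp [hST])⟩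
  obtain ⟨x, hx, rfl⟩ := Finset.mem_map.1 hy
  exact r.extendSubtype_mem (f x) (Finset.mem_map_of_mem _ hx)

/-- On the intersection the inequalities of both cones force equality, so it lies in the kernel of a
linear form; the work is to see that this form is nonzero. -/
theorem volume_facetCone_inter (g : ℕ → ℝ) (S T : Finset (Option ι)) (hne : S ≠ T)
    (hS : S.Nonempty) (hT : T.Nonempty) (hgS : 0 < g S.card) (hgT : 0 < g T.card) :
    volume (facetCone ι g S ∩ facetCone ι g T) = 0 := by
  classical
  set φ : (ι → ℝ) →ₗ[ℝ] ℝ :=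
    { toFun := fun z => (∑ o ∈ T, extend 0 z o) * g S.card - (∑ o ∈ S, extend 0 z o) * g T.card
      map_add' := fun z w => by
        have := extend_add 0 0 z w
        rw [add_zero] at this
        simp only [this, Pi.add_apply, Finset.sum_add_distrib]
        ring
      map_smul' := fun t z => by
        have := extend_smul t 0 z
        rw [mul_zero] at this
        simp only [this, Pi.smul_apply, smul_eq_mul, ← Finset.mul_sum, RingHom.id_apply]
        ring } with hφ
  have hsub : facetCone ι g S ∩ facetCone ι g T ⊆ LinearMap.ker φ := by
    rintro z ⟨⟨_, h₁⟩, ⟨_, h₂⟩⟩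
    have := le_antisymm (h₁ T) (h₂ S)
    rw [SetLike.mem_coe, LinearMap.mem_ker]
    change _ - _ = (0 : ℝ)
    rw [this, sub_self]
  refine measure_mono_null hsub (Measure.addHaar_submodule volume _ fun htop => ?_)
  -- Coefficients of `φ` in all coordinates. Since the coordinates sum to zero, `φ` vanishes only if
  -- `f` is constant.
  set f : Option ι → ℝ := fun o =>
    (if o ∈ T then g S.card else 0) - (if o ∈ S then g T.card else 0) with hf
  have hconst : ∀ o, f o = f none := by
    rintro (_ | i)
    · rfl
    have hz : φ (Pi.single i 1) = 0 := by
      rw [← LinearMap.mem_ker, htop]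
      trivial
    have hext : extend 0 (Pi.single i (1 : ℝ)) =
        fun o => (if o = some i then (1 : ℝ) else 0) - if o = none then 1 else 0 := by
      funext o
      rcases o with _ | o
      · simp
      · simp [Pi.single_apply]
    have hsum : ∀ U : Finset (Option ι), ∑ o ∈ U, extend 0 (Pi.single i (1 : ℝ)) o =
        (if some i ∈ U then 1 else 0) - if none ∈ U then 1 else 0 := by
      intro U
      rw [hext, Finset.sum_sub_distrib, Finset.sum_ite_eq', Finset.sum_ite_eq']
    change (∑ o ∈ T, extend 0 (Pi.single i (1 : ℝ)) o) * g S.card -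
      (∑ o ∈ S, extend 0 (Pi.single i (1 : ℝ)) o) * g T.card = 0 at hz
    rw [hsum, hsum, sub_mul, sub_mul] at hz
    simp only [ite_mul, one_mul, zero_mul] at hz
    simp only [hf]
    linarith
  have key : ∀ o o', f o = f o' := fun o o' => (hconst o).trans (hconst o').symm
  -- At an element of exactly one of the two sets, `f` has a value which it cannot take on the other
  -- set.
  have hcase : (∃ o ∈ T, o ∉ S) ∨ ∃ o ∈ S, o ∉ T := by
    by_contra! h
    exact hne (Finset.Subset.antisymm h.2 h.1)
  rcases hcase with ⟨o, hoT, hoS⟩ | ⟨o, hoS, hoT⟩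
  · obtain ⟨o', ho'⟩ := hS
    have := key o o'
    simp only [hf, hoT, hoS, ho', if_true, if_false] at this
    split_ifs at this <;> linarith
  · obtain ⟨o', ho'⟩ := hT
    have := key o o'
    simp only [hf, hoT, hoS, ho', if_true, if_false] at this
    split_ifs at this <;> linarith

/-- A point z lies in the cone of any S that maximizes z(S) / g(|S|) among the proper nonempty sets;
the inequalities defining the cones are this maximality with denominators cleared. The empty and the
full set contribute only 0 ≤ 0. -/
theorem majorized_eq_biUnion_facetCone [Nonempty ι] (g : ℕ → ℝ) (h0 : g 0 = 0)
    (hlast : g (Fintype.card ι + 1) = 0) (hpos : ∀ k ∈ Finset.Icc 1 (Fintype.card ι), 0 < g k) :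
    majorized ι g = ⋃ S ∈ (Finset.univ.filter fun S : Finset (Option ι) =>
      S.card ∈ Finset.Icc 1 (Fintype.card ι)), facetCone ι g S := by
  set F : Finset (Finset (Option ι)) :=
    Finset.univ.filter fun S => S.card ∈ Finset.Icc 1 (Fintype.card ι) with hF
  have hmem : ∀ {S}, S ∈ F ↔ S.card ∈ Finset.Icc 1 (Fintype.card ι) := by simp [hF]
  have htriv : ∀ T ∉ F, g T.card = 0 ∧ ∀ z : ι → ℝ, ∑ o ∈ T, extend 0 z o = 0 := by
    intro T hT
    rw [hmem, Finset.mem_Icc, not_and_or] at hT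
    have hle := T.card_le_univ
    rw [Fintype.card_option] at hle
    rcases hT with hT | hT
    · have : T = ∅ := Finset.card_eq_zero.1 (by omega)
      subst this
      simp [h0]
    · have : T = Finset.univ := Finset.card_eq_iff_eq_univ _ |>.1 (by
        rw [Fintype.card_option]
        omega)
      subst this
      simp [hlast]
  have hnonneg : ∀ T : Finset (Option ι), 0 ≤ g T.card := by
    intro T
    by_cases hT : T ∈ F
    · exact (hpos _ (hmem.1 hT)).le
    · rw [(htriv T hT).1]
  ext z
  simp only [Set.mem_iUnion, exists_prop]
  constructor
  · intro hz
    simp only [majorized, hlast, Set.mem_ofPred_eq] at hz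
    have hne : F.Nonempty := by
      refine ⟨{none}, hmem.2 ?_⟩
      rw [Finset.card_singleton, Finset.mem_Icc]
      exact ⟨le_rfl, Fintype.card_pos⟩
    obtain ⟨S, hS, hmax⟩ := F.exists_max_image (fun S => (∑ o ∈ S, extend 0 z o) / g S.card) hne
    refine ⟨S, hS, hz S, fun T => ?_⟩
    by_cases hT : T ∈ F
    · have := hmax T hT
      rwa [div_le_div_iff₀ (hpos _ (hmem.1 hT)) (hpos _ (hmem.1 hS))] at this
    · rw [(htriv T hT).1, (htriv T hT).2 z, zero_mul, mul_zero]
  · rintro ⟨S, hS, hS₁, hS₂⟩ T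
    rw [hlast]
    have hgS := hpos _ (hmem.1 hS)
    refine le_of_mul_le_mul_right ((hS₂ T).trans ?_) hgS
    rw [mul_comm (g T.card)]
    exact mul_le_mul_of_nonneg_right hS₁ (hnonneg T)

theorem volume_majorized_eq_sum_facetCone [Nonempty ι] (g : ℕ → ℝ) (h0 : g 0 = 0)
    (hlast : g (Fintype.card ι + 1) = 0) (hpos : ∀ k ∈ Finset.Icc 1 (Fintype.card ι), 0 < g k) :
    volume (majorized ι g) = ∑ S : Finset (Option ι) with S.card ∈ Finset.Icc 1 (Fintype.card ι),
      volume (facetCone ι g S) := by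
  rw [majorized_eq_biUnion_facetCone g h0 hlast hpos, measure_biUnion_finset₀]
  · intro S hS T hT hne
    rw [Finset.mem_coe, Finset.mem_filter] at hS hT
    exact volume_facetCone_inter g S T hne (Finset.card_pos.1 (Finset.mem_Icc.1 hS.2).1)
      (Finset.card_pos.1 (Finset.mem_Icc.1 hT.2).1) (hpos _ hS.2) (hpos _ hT.2)
  · exact fun S _ => (isClosed_facetCone g S).measurableSet.nullMeasurableSet

/-- The recursion for the volumes, from the decomposition into the cones over the facets. -/
theorem volume_majorized_recursion (n : ℕ) (hn : 1 ≤ n) (g : ℕ → ℝ) (h0 : g 0 = 0)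
    (hlast : g (n + 1) = 0) (hpos : ∀ k ∈ Finset.Icc 1 n, 0 < g k)
    (hconc : ∀ k < n, g k + g (k + 2) ≤ 2 * g (k + 1)) :
    volume.real (majorized (Fin n) g) = ∑ i ∈ Finset.Icc 1 n, (n + 1).choose i * (g i / n) *
      (volume.real (majorized (Fin (i - 1)) g) *
        volume.real (majorized (Fin (n - i)) fun k => g (i + k) - g i)) := by
  classical
  have : Nonempty (Fin n) := ⟨⟨0, hn⟩⟩
  have hcone : ∀ i ∈ Finset.Icc 1 n, ∀ S : Finset (Option (Fin n)), S.card = i →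
      volume (facetCone (Fin n) g S) = ENNReal.ofReal (g i / n) *
        (volume (majorized (Fin (i - 1)) g) *
          volume (majorized (Fin (n - i)) fun k => g (i + k) - g i)) := by
    intro i hi S hS
    have hi' := Finset.mem_Icc.1 hi
    -- Every set of size i is moved to the standard one, so all their cones have the same volume.
    obtain ⟨e, he⟩ := exists_equiv_map_eq S (leftIndices (Fin (i - 1)) (Fin (n - i)))
      (by simp; omega) (by rw [hS, card_leftIndices, Fintype.card_fin]; omega)
    rw [← volume_facetCone_map e, he, volume_facetCone_leftIndices g i]
    · rw [Fintype.card_fin, Fintype.card_fin, ← Nat.cast_add_one,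
        show i - 1 + (n - i) + 1 = n by omega]
    · rw [Fintype.card_fin]
      omega
    · rw [Fintype.card_fin, show i + (n - i + 1) = n + 1 by omega, hlast]
    · exact hpos i hi
    · rw [Fintype.card_fin]
      exact (hpos _ (by rw [Finset.mem_Icc]; omega)).le
    · intro p hp q hq
      rw [Fintype.card_fin] at hq
      exact add_le_add_of_concave n g hconc p i q hp (by omega)
  have h := volume_majorized_eq_sum_facetCone (ι := Fin n) g h0 (by rwa [Fintype.card_fin])
    (by rwa [Fintype.card_fin])
  rw [Fintype.card_fin, ← Finset.sum_fiberwise_of_maps_to (g := Finset.card)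
    (t := Finset.Icc 1 n) (fun S hS => (Finset.mem_filter.1 hS).2)] at h
  have hcount : ∀ i ∈ Finset.Icc 1 n,
      ∑ S ∈ (Finset.univ.filter fun S : Finset (Option (Fin n)) => S.card ∈ Finset.Icc 1 n) with
        S.card = i, volume (facetCone (Fin n) g S) =
      (n + 1).choose i * (ENNReal.ofReal (g i / n) * (volume (majorized (Fin (i - 1)) g) *
          volume (majorized (Fin (n - i)) fun k => g (i + k) - g i))) := by
    intro i hi
    rw [Finset.sum_congr rfl fun S hS => hcone i hi S (Finset.mem_filter.1 hS).2,
      Finset.sum_const, nsmul_eq_mul]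
    congr 2
    have : (Finset.univ.filter fun S : Finset (Option (Fin n)) => S.card ∈ Finset.Icc 1 n).filter
        (fun S => S.card = i) = Finset.powersetCard i Finset.univ := by
      ext S
      simp only [Finset.mem_filter, Finset.mem_univ, true_and, Finset.mem_powersetCard,
        Finset.subset_univ]
      exact ⟨fun h => h.2, fun h => ⟨h ▸ hi, h⟩⟩
    rw [this, Finset.card_powersetCard, Finset.card_univ, Fintype.card_option, Fintype.card_fin]
  rw [Finset.sum_congr rfl hcount] at h
  rw [measureReal_def, h, ENNReal.toReal_sum]
  · refine Finset.sum_congr rfl fun i hi => ?_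
    have : 0 ≤ g i / n := div_nonneg (hpos i hi).le (Nat.cast_nonneg n)
    rw [ENNReal.toReal_mul, ENNReal.toReal_mul, ENNReal.toReal_mul, ENNReal.toReal_natCast,
      ENNReal.toReal_ofReal this, mul_assoc]
    rfl
  · intro i _
    exact ENNReal.mul_ne_top (ENNReal.natCast_ne_top _) (ENNReal.mul_ne_top ENNReal.ofReal_ne_top
      (ENNReal.mul_ne_top (volume_majorized_lt_top g).ne (volume_majorized_lt_top _).ne))

end FacetDecomposition

/-! ### Volumes of majorization polytopes by induction on dimension -/

section VolumeOfMajorized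

open MeasureTheory

theorem volumePolynomial_eval_eq_zero (n : ℕ) (hn : 1 ≤ n) (x : ℕ → ℝ)
    (hx : ∀ j ∈ Finset.Icc 1 n, x j = 0) : MvPolynomial.eval x (volumePolynomial n) = 0 := by
  rw [volumePolynomial_eq_sum_Icc n hn, map_sum]
  refine Finset.sum_eq_zero fun i _ => ?_
  rw [map_mul, map_mul, eval_Gamma', Finset.sum_eq_zero fun j hj => by rw [hx j hj, mul_zero]]
  simp

theorem volume_majorized_of_eq_zero (n : ℕ) (hn : 1 ≤ n) (g : ℕ → ℝ)
    (hg : ∀ i ≤ n + 1, g i = 0) : volume (majorized (Fin n) g) = 0 := by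
  refine measure_mono_null (majorized_subset_Icc g) ?_
  rw [Fintype.card_fin, hg 1 (by omega), hg n (by omega), hg (n + 1) le_rfl, Real.volume_Icc_pi]
  refine Finset.prod_eq_zero (Finset.mem_univ (⟨0, hn⟩ : Fin n)) ?_
  simp

theorem volume_majorized_fin_zero (g : ℕ → ℝ) (h0 : g 0 = 0) :
    volume.real (majorized (Fin 0) g) = 1 := by
  have : majorized (Fin 0) g = Set.univ := by
    refine Set.eq_univ_of_forall fun z T => ?_
    obtain rfl | h := T.eq_empty_or_nonempty
    · simp [h0]
    · obtain rfl : T = Finset.univ := by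
        rw [← Finset.card_eq_iff_eq_univ]
        have h1 := Finset.card_pos.2 h
        have h2 := T.card_le_univ
        simp at h2 ⊢
        omega
      rw [sum_extend, Finset.card_univ, Fintype.card_option]
  rw [this, measureReal_def, Measure.volume_pi_eq_dirac (default : Fin 0 → ℝ)]
  simp

/-- The inductive step. If all x_j vanish, the polytope has volume zero and so does the polynomial.
Otherwise the positivity of the inverse Cartan matrix makes g positive on 1, …, n, as the
decomposition into cones requires. -/
theorem volume_majorized_eq_eval_of_last_eq_zero (n : ℕ) (hn : 1 ≤ n) (g x : ℕ → ℝ)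
    (h0 : g 0 = 0) (hlast : g (n + 1) = 0)
    (hx : ∀ k < n, x (k + 1) = 2 * g (k + 1) - g k - g (k + 2))
    (hnonneg : ∀ k < n, 0 ≤ x (k + 1))
    (ih : ∀ m < n, ∀ g x : ℕ → ℝ, g 0 = 0 →
      (∀ k < m, x (k + 1) = 2 * g (k + 1) - g k - g (k + 2)) → (∀ k < m, 0 ≤ x (k + 1)) →
        √(m + 1 : ℝ) * volume.real (majorized (Fin m) g) =
          MvPolynomial.eval x (volumePolynomial m)) :
    √(n + 1 : ℝ) * volume.real (majorized (Fin n) g) =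
      MvPolynomial.eval x (volumePolynomial n) := by
  have hg := eq_sum_c_mul n g x h0 hlast hx
  have hnonneg' : ∀ j ∈ Finset.Icc 1 n, 0 ≤ x j := by
    intro j hj
    rw [Finset.mem_Icc] at hj
    have := hnonneg (j - 1) (by omega)
    rwa [Nat.sub_add_cancel hj.1] at this
  by_cases hzero : ∀ j ∈ Finset.Icc 1 n, x j = 0
  · rw [volumePolynomial_eval_eq_zero n hn x hzero, measureReal_def,
      volume_majorized_of_eq_zero n hn g fun i hi => by
        rw [hg i hi]
        exact Finset.sum_eq_zero fun j hj => by rw [hzero j hj, mul_zero]]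
    simp
  · push Not at hzero
    obtain ⟨j₀, hj₀, hne⟩ := hzero
    have hpos : ∀ i ∈ Finset.Icc 1 n, 0 < g i := by
      intro i hi
      rw [hg i (by rw [Finset.mem_Icc] at hi; omega)]
      exact Finset.sum_pos' (fun j hj => mul_nonneg (c_pos n i j hi hj).le (hnonneg' j hj))
        ⟨j₀, hj₀, mul_pos (c_pos n i j₀ hi hj₀) (lt_of_le_of_ne (hnonneg' j₀ hj₀) hne.symm)⟩
    rw [volume_majorized_recursion n hn g h0 hlast hpos
      fun k hk => by linarith [hx k hk, hnonneg k hk],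
      volumePolynomial_eq_sum_Icc n hn, map_sum, Finset.mul_sum]
    refine Finset.sum_congr rfl fun i hi => ?_
    have hi' := Finset.mem_Icc.1 hi
    rw [map_mul, map_mul, eval_Gamma', eval_shift, ← hg i (by omega),
      ← ih (i - 1) (by omega) g x h0 (fun k hk => hx k (by omega))
        (fun k hk => hnonneg k (by omega)),
      -- The second differences of the translated sequence are those of g moved by i, which accounts
      -- for the shift.
      ← ih (n - i) (by omega) (fun k => g (i + k) - g i) (fun j => x (j + i)) (by simp)
        (fun k hk => by
          have := hx (i + k) (by omega)
          rw [show k + 1 + i = i + k + 1 by ring, this]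
          simp only [← add_assoc]
          ring)
        (fun k hk => by
          have := hnonneg (i + k) (by omega)
          rwa [show k + 1 + i = i + k + 1 by ring])]
    have e1 : ((i - 1 : ℕ) : ℝ) + 1 = i := by
      rw [Nat.cast_sub hi'.1]
      simp
    have e2 : ((n - i : ℕ) : ℝ) + 1 = n + 1 - i := by
      rw [Nat.cast_sub hi'.2]
      ring
    have hin : (i : ℝ) ≤ n := by exact_mod_cast hi'.2
    have hi0 : (0 : ℝ) < i := by exact_mod_cast hi'.1
    -- The three normalizing square roots, of dimensions n, i - 1 and n - i, combine to the root in
    -- the denominator of `Gamma'`.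
    have hc : √(n + 1 : ℝ) * √(c n i i) = √(i : ℝ) * √(n + 1 - i : ℝ) := by
      rw [← Real.sqrt_mul (by positivity), ← Real.sqrt_mul (by positivity), c_self]
      congr 1
      have : (n : ℝ) + 1 ≠ 0 := by positivity
      field_simp
    have hc0 : √(c n i i) ≠ 0 := (Real.sqrt_pos.2 (c_pos n i i hi hi)).ne'
    have hn0 : (n : ℝ) ≠ 0 := by positivity
    rw [e1, e2]
    field_simp
    linear_combination (((n + 1).choose i : ℝ) * g i * volume.real (majorized (Fin (i - 1)) g) *
      volume.real (majorized (Fin (n - i)) fun k => g (i + k) - g i)) * hc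

/-- The volume polynomials describe the volumes of the polytopes `majorized (Fin n) g` for
concave `g`. -/
theorem volume_majorized_eq_eval (n : ℕ) : ∀ g x : ℕ → ℝ, g 0 = 0 →
    (∀ k < n, x (k + 1) = 2 * g (k + 1) - g k - g (k + 2)) → (∀ k < n, 0 ≤ x (k + 1)) →
      √(n + 1 : ℝ) * volume.real (majorized (Fin n) g) =
        MvPolynomial.eval x (volumePolynomial n) := by
  induction n using Nat.strong_induction_on with
  | _ n ih =>
    intro g x h0 hx hnonneg
    obtain rfl | hn := Nat.eq_zero_or_pos n
    · rw [volume_majorized_fin_zero g h0, volumePolynomial_zero]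
      simp
    -- The slope that makes the last value zero; second differences are unaffected.
    · set r : ℝ := -(g (n + 1) / (n + 1)) with hr
      have hn0 : (n : ℝ) + 1 ≠ 0 := by positivity
      rw [measureReal_def, ← volume_majorized_add_linear g r, ← measureReal_def]
      refine volume_majorized_eq_eval_of_last_eq_zero n hn _ x (by simp [h0]) ?_ ?_ hnonneg ih
      · rw [hr]
        push_cast
        field_simp
        ring
      · intro k hk
        rw [hx k hk]
        push_cast
        ring

end VolumeOfMajorized

/-! ### The Weyl group as the group of coordinate permutations -/

section WeylGroup

theorem inner_eq_sum (n : ℕ) (v w : E n) : ⟪v, w⟫_ℝ = ∑ k, v.1 k * w.1 k := by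
  rw [Submodule.coe_inner, PiLp.inner_apply]
  exact Finset.sum_congr rfl fun k _ => mul_comm _ _

theorem inner_simpleRoot (n : ℕ) (v : E n) (i : Fin n) :
    ⟪v, simpleRoot n i⟫_ℝ = v.1 i.castSucc - v.1 i.succ := by
  rw [Submodule.coe_inner]
  simp [simpleRoot, inner_sub_right, EuclideanSpace.inner_single_right]

/-- A simple root has squared length 2, so the reflection subtracts (v_i - v_{i+1}) times the root,
which exchanges these two coordinates. -/
theorem simpleReflection_apply (n : ℕ) (i : Fin n) (v : E n) (k : Fin (n + 1)) :
    (simpleReflection n i v).1 k = v.1 (Equiv.swap i.castSucc i.succ k) := by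
  have hne : i.castSucc ≠ i.succ := i.castSucc_lt_succ.ne
  have hnorm : ‖simpleRoot n i‖ ^ 2 = 2 := by
    rw [← real_inner_self_eq_norm_sq, inner_simpleRoot]
    simp [simpleRoot, hne, hne.symm]
    norm_num
  have hrefl : simpleReflection n i v =
      v - (v.1 i.castSucc - v.1 i.succ) • simpleRoot n i := by
    rw [simpleReflection, Submodule.reflection_orthogonal_apply,
      Submodule.reflection_singleton_apply, neg_sub, real_inner_comm, inner_simpleRoot]
    simp only [RCLike.ofReal_real_eq_id, id]
    rw [hnorm, ← Nat.cast_smul_eq_nsmul ℝ, smul_smul, Nat.cast_ofNat,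
      mul_div_cancel₀ _ (two_ne_zero' ℝ)]
  rw [hrefl]
  have hcoe : (v - (v.1 i.castSucc - v.1 i.succ) • simpleRoot n i).1 k = v.1 k -
      (v.1 i.castSucc - v.1 i.succ) *
        ((if k = i.castSucc then 1 else 0) - (if k = i.succ then 1 else 0)) := by
    simp [simpleRoot]
  rw [hcoe]
  rcases eq_or_ne k i.castSucc with rfl | h1
  · simp [hne]
  · rcases eq_or_ne k i.succ with rfl | h2
    · simp [hne.symm]
    · rw [Equiv.swap_apply_of_ne_of_ne h1 h2]
      simp [h1, h2]

theorem inner_sum_smul (n : ℕ) (a : Fin n → ℝ) (u : Fin n → E n) (v : E n) :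
    ⟪∑ i, a i • u i, v⟫_ℝ = ∑ i, a i * ⟪u i, v⟫_ℝ := by
  rw [sum_inner]
  exact Finset.sum_congr rfl fun i _ => real_inner_smul_left (F := E n) (u i) v (a i)

theorem exists_perm_of_mem_weylGroup (n : ℕ) (w : E n ≃ₗᵢ[ℝ] E n) (hw : w ∈ weylGroup n) :
    ∃ σ : Equiv.Perm (Fin (n + 1)), ∀ v k, (w v).1 k = v.1 (σ k) := by
  induction hw using Subgroup.closure_induction with
  | mem w hw =>
    obtain ⟨i, rfl⟩ := hw
    exact ⟨_, simpleReflection_apply n i⟩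
  | one => exact ⟨1, fun _ _ => rfl⟩
  | mul w₁ w₂ _ _ h₁ h₂ =>
    obtain ⟨σ₁, h₁⟩ := h₁
    obtain ⟨σ₂, h₂⟩ := h₂
    -- Precomposition with a permutation is contravariant, so the factors change order.
    refine ⟨σ₂ * σ₁, fun v k => ?_⟩
    rw [LinearIsometryEquiv.coe_mul, Function.comp_apply, h₁, h₂, Equiv.Perm.mul_apply]
  | inv w _ h =>
    obtain ⟨σ, h⟩ := h
    refine ⟨σ⁻¹, fun v k => ?_⟩
    have := h (w⁻¹ v) (σ⁻¹ k)
    rw [show σ (σ⁻¹ k) = k from σ.apply_symm_apply k] at this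
    rw [← this]
    exact congrArg (fun u : E n => u.1 (σ⁻¹ k)) (w.apply_symm_apply v)

theorem exists_mem_weylGroup_of_perm (n : ℕ) (σ : Equiv.Perm (Fin (n + 1))) :
    ∃ w ∈ weylGroup n, ∀ v k, (w v).1 k = v.1 (σ k) := by
  have hσ : σ ∈ Submonoid.closure
      (Set.range fun i : Fin n => Equiv.swap i.castSucc i.succ) := by
    rw [Equiv.Perm.mclosure_swap_castSucc_succ]
    trivial
  induction hσ using Submonoid.closure_induction with
  | mem σ hσ =>
    obtain ⟨i, rfl⟩ := hσ
    exact ⟨_, Subgroup.subset_closure ⟨i, rfl⟩, simpleReflection_apply n i⟩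
  | one => exact ⟨1, one_mem _, fun _ _ => rfl⟩
  | mul σ₁ σ₂ _ _ h₁ h₂ =>
    obtain ⟨w₁, hw₁, h₁⟩ := h₁
    obtain ⟨w₂, hw₂, h₂⟩ := h₂
    refine ⟨w₂ * w₁, mul_mem hw₂ hw₁, fun v k => ?_⟩
    rw [LinearIsometryEquiv.coe_mul, Function.comp_apply, h₂, h₁, Equiv.Perm.mul_apply]

/-- Finiteness makes the convex hull closed, as needed to separate a point from it. -/
theorem finite_orbit (n : ℕ) (v : E n) : {u | ∃ w ∈ weylGroup n, w v = u}.Finite := by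
  refine (Set.finite_range fun σ : Equiv.Perm (Fin (n + 1)) =>
    (exists_mem_weylGroup_of_perm n σ).choose v).subset ?_
  rintro _ ⟨w, hw, rfl⟩
  obtain ⟨σ, hσ⟩ := exists_perm_of_mem_weylGroup n w hw
  refine ⟨σ, Subtype.ext ?_⟩
  ext k
  rw [hσ]
  exact (exists_mem_weylGroup_of_perm n σ).choose_spec.2 v k

end WeylGroup

/-! ### Rado's theorem: the inequalities of the permutohedron -/

section Rado

theorem sum_fundamentalWeight (n : ℕ) (i : Fin n) (T : Finset (Fin (n + 1))) :
    ∑ k ∈ T, (fundamentalWeight n i).1 k =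
      (T.filter fun k : Fin (n + 1) => (k : ℕ) ≤ i).card - (T.card : ℝ) * (i + 1) / (n + 1) := by
  simp only [fundamentalWeight, Finset.sum_sub_distrib, Finset.sum_boole, Finset.sum_const,
    nsmul_eq_mul, mul_div_assoc]

/-- At most min(|T|, i + 1) of the large coordinates of the weight have their index in T. -/
theorem sum_fundamentalWeight_le (n : ℕ) (i : Fin n) (T : Finset (Fin (n + 1))) :
    ∑ k ∈ T, (fundamentalWeight n i).1 k ≤ c n T.card (i + 1) := by
  have h : (T.filter fun k : Fin (n + 1) => (k : ℕ) ≤ i).card ≤ min T.card (i + 1) := by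
    refine le_min (Finset.card_filter_le _ _) ?_
    have hsub : (T.filter fun k : Fin (n + 1) => (k : ℕ) ≤ i) ⊆ Finset.Iic i.castSucc := by
      intro k hk
      rw [Finset.mem_Iic, Fin.le_def]
      exact (Finset.mem_filter.1 hk).2
    simpa using Finset.card_le_card hsub
  rw [sum_fundamentalWeight, c]
  push_cast
  have : ((T.filter fun k : Fin (n + 1) => (k : ℕ) ≤ i).card : ℝ) ≤ (min T.card (i + 1) : ℕ) := by
    exact_mod_cast h
  push_cast at this
  linarith

theorem sum_Icc_eq_sum_fin (n : ℕ) (f : ℕ → ℝ) :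
    ∑ j ∈ Finset.Icc 1 n, f j = ∑ i : Fin n, f (i + 1) := by
  rw [Fin.sum_univ_eq_sum_range (fun i => f (i + 1)), ← Finset.Ico_add_one_right_eq_Icc,
    Finset.sum_Ico_eq_sum_range]
  simp [add_comm]

theorem sum_weight_le (n : ℕ) (x : ℕ → ℝ) (hx : ∀ j ∈ Finset.Icc 1 n, 0 ≤ x j)
    (T : Finset (Fin (n + 1))) :
    ∑ k ∈ T, (∑ i : Fin n, x (i + 1) • fundamentalWeight n i).1 k ≤
      ∑ j ∈ Finset.Icc 1 n, c n T.card j * x j := by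
  have h : ∀ k, (∑ i : Fin n, x (i + 1) • fundamentalWeight n i).1 k =
      ∑ i : Fin n, x (i + 1) * (fundamentalWeight n i).1 k := by
    intro k
    rw [Submodule.coe_sum, WithLp.ofLp_sum, Finset.sum_apply]
    rfl
  simp only [h]
  rw [Finset.sum_comm, sum_Icc_eq_sum_fin]
  refine Finset.sum_le_sum fun i _ => ?_
  rw [← Finset.mul_sum, mul_comm]
  refine mul_le_mul_of_nonneg_right (sum_fundamentalWeight_le n i T) (hx _ ?_)
  have := i.2
  rw [Finset.mem_Icc]
  omega

theorem inner_fundamentalWeight_eq_sum (n : ℕ) (i : Fin n) (v : E n) :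
    ⟪fundamentalWeight n i, v⟫_ℝ = ∑ k ∈ Finset.Iic i.castSucc, v.1 k := by
  have hv : ∑ k, v.1 k = 0 := v.2
  have hIic : Finset.Iic i.castSucc = Finset.univ.filter fun k : Fin (n + 1) => (k : ℕ) ≤ i := by
    ext k
    simp [Fin.le_def]
  rw [inner_eq_sum, hIic, Finset.sum_filter]
  simp only [fundamentalWeight, sub_mul, ite_mul, one_mul, zero_mul, Finset.sum_sub_distrib,
    ← Finset.mul_sum, hv, mul_zero, sub_zero]

theorem inner_fundamentalWeight_weight (n : ℕ) (i : Fin n) (x : ℕ → ℝ) :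
    ⟪fundamentalWeight n i, ∑ l : Fin n, x (l + 1) • fundamentalWeight n l⟫_ℝ =
      ∑ j ∈ Finset.Icc 1 n, c n (i + 1) j * x j := by
  rw [← sum_c_smul_simpleRoot, inner_sum_smul, sum_Icc_eq_sum_fin]
  refine Finset.sum_congr rfl fun j _ => ?_
  rw [real_inner_comm, inner_sum_smul]
  simp only [inner_fundamentalWeight_simpleRoot]
  simp

theorem eq_sum_inner_simpleRoot_smul (n : ℕ) (v : E n) :
    v = ∑ i : Fin n, ⟪v, simpleRoot n i⟫_ℝ • fundamentalWeight n i := by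
  refine eq_of_inner_simpleRoot n _ _ fun j => ?_
  rw [inner_sum_smul]
  simp only [inner_fundamentalWeight_simpleRoot]
  simp

/-- The permutohedron of a dominant weight is described by the majorization inequalities. -/
theorem mem_permutohedron_iff (n : ℕ) (x : ℕ → ℝ) (hx : ∀ j ∈ Finset.Icc 1 n, 0 ≤ x j)
    (y : E n) : y ∈ permutohedron n (∑ i : Fin n, x (i + 1) • fundamentalWeight n i) ↔
      ∀ T : Finset (Fin (n + 1)),
        ∑ k ∈ T, y.1 k ≤ ∑ j ∈ Finset.Icc 1 n, c n T.card j * x j := by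
  set v : E n := ∑ i : Fin n, x (i + 1) • fundamentalWeight n i with hv
  constructor
  · intro hy T
    have hconv : Convex ℝ {y : E n | ∑ k ∈ T, y.1 k ≤ ∑ j ∈ Finset.Icc 1 n, c n T.card j * x j} := by
      refine convex_halfSpace_le ⟨fun a b => ?_, fun t a => ?_⟩ _
      · simp [Finset.sum_add_distrib]
      · simp [Finset.mul_sum]
    refine convexHull_min ?_ hconv hy
    rintro _ ⟨w, hw, rfl⟩
    obtain ⟨σ, hσ⟩ := exists_perm_of_mem_weylGroup n w hw
    simp only [Set.mem_ofPred_eq, hσ]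
    have h := sum_weight_le n x hx (T.map σ.toEmbedding)
    rwa [Finset.sum_map, Finset.card_map] at h
  · intro hy
    by_contra hmem
    -- A functional separating y from the hull is represented by a vector F and moved by the Weyl
    -- group into the dominant chamber.
    obtain ⟨f, u, hf, hu⟩ := geometric_hahn_banach_closed_point
      (convex_convexHull ℝ {u | ∃ w ∈ weylGroup n, w v = u})
      ((finite_orbit n v).isClosed_convexHull ℝ) hmem
    set F : E n := (InnerProductSpace.toDual ℝ (E n)).symm f with hF
    have hFf : ∀ a, ⟪F, a⟫_ℝ = f a := fun a => InnerProductSpace.toDual_symm_apply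
    obtain ⟨w, hw, hσ⟩ := exists_mem_weylGroup_of_perm n (Tuple.sort fun k => -F.1 k)
    set σ := Tuple.sort fun k => -F.1 k
    have hmono : ∀ i : Fin n, 0 ≤ ⟪w F, simpleRoot n i⟫_ℝ := by
      intro i
      have : -F.1 (σ i.castSucc) ≤ -F.1 (σ i.succ) :=
        Tuple.monotone_sort (fun k => -F.1 k) i.castSucc_lt_succ.le
      rw [inner_simpleRoot, hσ, hσ]
      linarith
    -- Abel summation: the dominant vector `w F` is a nonnegative combination of fundamental
    -- weights, and pairing with these gives partial sums of coordinates, which `hy` bounds by those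
    -- of v.
    have hle : ⟪w F, w y⟫_ℝ ≤ ⟪w F, v⟫_ℝ := by
      rw [eq_sum_inner_simpleRoot_smul n (w F), inner_sum_smul, inner_sum_smul]
      refine Finset.sum_le_sum fun i _ => ?_
      refine mul_le_mul_of_nonneg_left ?_ (hmono i)
      rw [hv, inner_fundamentalWeight_weight, inner_fundamentalWeight_eq_sum]
      simp only [hσ]
      have h := hy ((Finset.Iic i.castSucc).map σ.toEmbedding)
      rw [Finset.sum_map, Finset.card_map, Fin.card_Iic] at h
      exact h
    have hinv : ⟪F, w⁻¹ v⟫_ℝ = ⟪w F, v⟫_ℝ := by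
      rw [← w.inner_map_map F (w⁻¹ v)]
      congr 1
      exact w.apply_symm_apply v
    have h1 := hf (w⁻¹ v) (subset_convexHull ℝ _ ⟨w⁻¹, inv_mem hw, rfl⟩)
    rw [← hFf, hinv] at h1
    rw [← hFf, ← w.inner_map_map] at hu
    linarith

end Rado

/-! ### From Euclidean volume to Lebesgue measure, and conclusion -/

section Coordinates

open MeasureTheory

/-- Both sides are Haar measures, so it suffices to compare them on the parallelepiped spanned by
the image of the standard basis. -/
theorem euclideanVolume_eq_sqrt_det_gram {U : Type*} [NormedAddCommGroup U]
    [InnerProductSpace ℝ U] [FiniteDimensional ℝ U] [MeasurableSpace U] [BorelSpace U] {n : ℕ}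
    (φ : (Fin n → ℝ) ≃ₗ[ℝ] U) (A : Set U) : euclideanVolume U A =
      ENNReal.ofReal √(Matrix.gram ℝ fun i => φ (Pi.single i 1)).det * volume (φ ⁻¹' A) := by
  set b : Module.Basis (Fin n) ℝ U := (Pi.basisFun ℝ (Fin n)).map φ with hb
  have hbi : (fun i => φ (Pi.single i 1)) = b := by
    funext i
    simp [hb]
  have hfin : Module.finrank ℝ U = n := by
    rw [← φ.finrank_eq, Module.finrank_fin_fun]
  set o : OrthonormalBasis (Fin n) ℝ U :=
    (stdOrthonormalBasis ℝ U).reindex (finCongr hfin) with ho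
  have hdet : √(Matrix.gram ℝ b).det = |o.toBasis.det b| := by
    rw [Matrix.gram_eq_conjTranspose_mul o b, Matrix.det_mul, Matrix.det_conjTranspose,
      star_trivial, Real.sqrt_mul_self_eq_abs, Module.Basis.det_apply]
    rfl
  have hvol : euclideanVolume U (parallelepiped b) = ENNReal.ofReal |o.toBasis.det b| := by
    rw [euclideanVolume, ← o.addHaar_eq_volume, Measure.addHaar_parallelepiped]
  have hmap : Measure.map φ volume = b.addHaar := by
    rw [← addHaarMeasure_eq_volume_pi, ← Module.Basis.parallelepiped_basisFun,
      ← Module.Basis.addHaar_def]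
    exact Module.Basis.map_addHaar _ φ.toContinuousLinearEquiv
  have hμ : euclideanVolume U = euclideanVolume U b.parallelepiped • b.addHaar := by
    rw [Module.Basis.addHaar_def, euclideanVolume]
    exact Measure.addHaarMeasure_unique _ _
  rw [hbi, hdet, ← hvol]
  refine (congrArg (fun μ => μ A) hμ).trans ?_
  rw [Measure.smul_apply, smul_eq_mul, Module.Basis.coe_parallelepiped, ← hmap]
  congr 1
  exact φ.toContinuousLinearEquiv.toHomeomorph.toMeasurableEquiv.map_apply A

/-- All coordinates but the last on the hyperplane `E n`. -/
def coordinates (n : ℕ) : (Fin n → ℝ) ≃ₗ[ℝ] E n where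
  toFun z := ⟨WithLp.toLp 2 fun k => extend 0 z (finSuccEquivLast k),
    (Equiv.sum_comp finSuccEquivLast (extend 0 z)).trans (sum_extend 0 z)⟩
  map_add' z w := by
    apply Subtype.ext
    ext k
    have := extend_add 0 0 z w
    rw [add_zero] at this
    simp [this]
  map_smul' t z := by
    apply Subtype.ext
    ext k
    have := extend_smul t 0 z
    rw [mul_zero] at this
    simp [this]
  invFun v i := v.1 i.castSucc
  left_inv z := by
    funext i
    simp
  right_inv v := by
    have hv : ∑ k, v.1 k = 0 := v.2
    apply Subtype.ext
    ext k
    refine Fin.lastCases ?_ (fun i => ?_) k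
    · rw [Fin.sum_univ_castSucc] at hv
      simp
      linarith
    · simp

theorem coordinates_apply (n : ℕ) (z : Fin n → ℝ) (k : Fin (n + 1)) :
    (coordinates n z).1 k = extend 0 z (finSuccEquivLast k) := rfl

/-- The basis vectors are ε_i - ε_{n+1}, so the Gram matrix is the identity plus the all-ones
matrix, a perturbation of rank at most one. -/
theorem det_gram_coordinates (n : ℕ) :
    (Matrix.gram ℝ fun i => coordinates n (Pi.single i 1)).det = n + 1 := by
  have h : (Matrix.gram ℝ fun i => coordinates n (Pi.single i 1)) =
      1 + Matrix.replicateCol Unit (fun _ : Fin n => (1 : ℝ)) *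
        Matrix.replicateRow Unit fun _ : Fin n => (1 : ℝ) := by
    ext i j
    rw [Matrix.gram_apply, inner_eq_sum, Fin.sum_univ_castSucc]
    simp only [coordinates_apply, finSuccEquivLast_castSucc, finSuccEquivLast_last, extend_some,
      extend_none]
    simp [Matrix.one_apply, Pi.single_apply, Matrix.mul_apply, eq_comm]
  rw [h, Matrix.det_one_add_mul_comm]
  simp [dotProduct, add_comm]

theorem euclideanVolume_permutohedron (n : ℕ) (x : ℕ → ℝ) (hx : ∀ j ∈ Finset.Icc 1 n, 0 ≤ x j) :
    (euclideanVolume (E n)).real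
        (permutohedron n (∑ i : Fin n, x (i + 1) • fundamentalWeight n i)) =
      √(n + 1 : ℝ) * volume.real
        (majorized (Fin n) fun i => ∑ j ∈ Finset.Icc 1 n, c n i j * x j) := by
  rw [measureReal_def, euclideanVolume_eq_sqrt_det_gram (coordinates n), det_gram_coordinates,
    ENNReal.toReal_mul, ENNReal.toReal_ofReal (Real.sqrt_nonneg _), ← measureReal_def]
  congr 2
  ext z
  have hlast : ∑ j ∈ Finset.Icc 1 n, c n (Fintype.card (Fin n) + 1) j * x j = 0 := by
    refine Finset.sum_eq_zero fun j hj => ?_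
    rw [Finset.mem_Icc] at hj
    rw [Fintype.card_fin, c_last_left _ _ (by omega), zero_mul]
  rw [Set.mem_preimage, mem_permutohedron_iff n x hx]
  simp only [majorized, Set.mem_ofPred_eq, hlast, coordinates_apply]
  refine ⟨fun h T => ?_, fun h T => ?_⟩
  · have := h (T.map finSuccEquivLast.symm.toEmbedding)
    rw [Finset.sum_map, Finset.card_map] at this
    simpa using this
  · have := h (T.map finSuccEquivLast.toEmbedding)
    rw [Finset.sum_map, Finset.card_map] at this
    simpa using this

theorem isVolumePolynomial_volumePolynomial (n : ℕ) :
    IsVolumePolynomial n (volumePolynomial n) := by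
  refine ⟨vars_volumePolynomial_subset n, fun x hx => ?_⟩
  rw [euclideanVolume_permutohedron n x hx]
  refine (volume_majorized_eq_eval n _ x (by simp [c_zero_left]) (fun k hk => ?_)
    fun k hk => hx _ (by rw [Finset.mem_Icc]; omega)).symm
  rw [Finset.mul_sum, ← Finset.sum_sub_distrib, ← Finset.sum_sub_distrib]
  have : ∀ j ∈ Finset.Icc 1 n, 2 * (c n (k + 1) j * x j) - c n k j * x j - c n (k + 2) j * x j =
      if k + 1 = j then x j else 0 := by
    intro j _
    rw [show 2 * (c n (k + 1) j * x j) - c n k j * x j - c n (k + 2) j * x j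
      = (2 * c n (k + 1) j - c n k j - c n (k + 2) j) * x j by ring, two_mul_c_sub_sub]
    simp
  rw [Finset.sum_congr rfl this, Finset.sum_ite_eq, if_pos]
  rw [Finset.mem_Icc]
  omega

theorem isVolumePolynomial_iff (n : ℕ) (p : MvPolynomial ℕ ℝ) :
    IsVolumePolynomial n p ↔ p = volumePolynomial n := by
  refine ⟨fun h => ?_, fun h => h ▸ isVolumePolynomial_volumePolynomial n⟩
  refine eq_of_eval_nonneg_eq _ _ fun x hx => ?_
  rw [h.2 x fun j _ => hx j, (isVolumePolynomial_volumePolynomial n).2 x fun j _ => hx j]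

end Coordinates

end Permutohedron

theorem mainTheorem3 :
    ∃ V : ℕ → MvPolynomial ℕ ℝ,
      (∀ n p, Permutohedron.IsVolumePolynomial n p ↔ p = V n) ∧
      (∀ n, (V n).IsHomogeneous n) ∧
      V 0 = 1 ∧
      ∀ n, 1 ≤ n →
        V n = ∑ i ∈ Finset.Icc 1 n,
          Permutohedron.Gamma' n i * V (i - 1) * Permutohedron.shift i (V (n - i)) :=
  ⟨Permutohedron.volumePolynomial, Permutohedron.isVolumePolynomial_iff,
    Permutohedron.isHomogeneous_volumePolynomial, Permutohedron.volumePolynomial_zero,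
    Permutohedron.volumePolynomial_eq_sum_Icc⟩
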